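/- Let $X$ be a complex Banach space and $\mathcal{L}(X)$ the algebra of bounded linear operators on $X$. An operator is called Fredholm if its null space has finite dimension and its range has finite codimension. An operator $T\in\mathcal{L}(X)$ is called B-Fredholm if for some integer $n\ge 0$ the range $R(T^n)$ is closed and the restriction $T_{|n|}:R(T^n)\to R(T^n)$ of $T$ is a Fredholm operator. Put $$\sigma_{BF}(T)=\{\lambda\in\mathbb{C} : T-\lambda I \text{ is not B-Fredholm}\}.$$ Let $A,B,C\in\mathcal{L}(X)$ satisfy $(ABA)B=(ACA)B$ and $(ABA)C=(ACA)C$. Then $$\sigma_{BF}(AC)=\sigma_{BF}(BA).$$ -/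

import Mathlib

namespace BFredholm

variable {X : Type*} [NormedAddCommGroup X] [NormedSpace ℂ X]

/-- A bounded operator is Fredholm if its null space is finite-dimensional and its range has
finite codimension. -/
def IsFredholmOp (T : X →L[ℂ] X) : Prop :=
  FiniteDimensional ℂ T.ker ∧ FiniteDimensional ℂ (X ⧸ T.range)

/-- `T` maps `R(T ^ n)` into itself. -/
theorem mem_range_pow (T : X →L[ℂ] X) (n : ℕ) :
    ∀ x ∈ (T ^ n).range, T x ∈ (T ^ n).range := by
  rintro _ ⟨y, rfl⟩
  refine ⟨T y, ?_⟩
  change (T ^ n * T) y = (T * T ^ n) y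
  rw [← pow_succ, ← pow_succ']

/-- The restriction of `T` to `R(T ^ n)`, as a bounded operator from `R(T ^ n)` to itself. -/
def restrictRangePow (T : X →L[ℂ] X) (n : ℕ) : (T ^ n).range →L[ℂ] (T ^ n).range :=
  T.restrict (mem_range_pow T n)

/-- `T` is B-Fredholm if, for some natural number `n`, the range of `T ^ n` is closed and the
restriction of `T` to that range is a Fredholm operator. -/
def IsBFredholm (T : X →L[ℂ] X) : Prop :=
  ∃ n : ℕ, IsClosed ((T ^ n).range : Set X) ∧ IsFredholmOp (restrictRangePow T n)

/-- The B-Fredholm spectrum: all `z : ℂ` such that `T - z I` is not B-Fredholm. -/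
def bFredholmSpectrum (T : X →L[ℂ] X) : Set ℂ :=
  {z : ℂ | ¬ IsBFredholm (T - z • (1 : X →L[ℂ] X))}

end BFredholm

/-!
B-Fredholmness of `T` means that for some `n` the space `R(T ^ n)` is closed, `ker T ⊓ R(T ^ n)`
is finite-dimensional, and `R(T ^ n)` exceeds `R(T ^ (n + 1))` by a finite-dimensional space
(`isBFredholm_iff`). Put `J = B * A * C` and `K = A * B * A`. The hypotheses on `A`, `B`, `C` give
`(B * A) * J = J * (A * C)`, `(A * C) * K = K * (B * A)`, `K * J = (A * C) ^ 3` and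
`J * K = (B * A) ^ 3`.
So `J` and `K` intertwine `T = A * C - z` with `S = B * A - z` for every `z`, and
`K * J = (T + z) ^ 3`, `J * K = (S + z) ^ 3`. This picture is symmetric in `T` and `S`, so it is
enough to pass from `T` to `S`.

If `z ≠ 0`, then `(S + z) ^ 3` is coprime to every power of `S`, so `J * K` is invertible modulo
`S ^ n`, and the three conditions at `n` transfer along `K` directly
(`IsBFredholm.of_intertwine_of_coprime`).

If `z = 0`, then `S ^ (n + 3) = J * T ^ n * K`, so `R(S ^ (n + 3)) ⊆ J (R(T ^ n))`, and the two
finiteness conditions at `n + 3` follow from those on `R(T ^ n)`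
(`IsBFredholm.of_intertwine_of_mul_eq_pow`). For closedness, `K * J = T ^ 3` has closed range and
finite-dimensional kernel on the Banach space `R(T ^ n)`, hence so has `J`
(`isClosed_range_of_comp`); and `R(S ^ (n + 3))` has finite codimension in the closed subspace
`J (R(T ^ n))`, which forces it to be closed because it is the range of a bounded operator
(`isClosed_range_of_isClosed_sup`).
-/

namespace BFredholm

/-! ### Closed ranges in Banach spaces -/

section ClosedRange

variable {E F G : Type*} [NormedAddCommGroup E] [NormedSpace ℂ E] [CompleteSpace E]
  [NormedAddCommGroup F] [NormedSpace ℂ F]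
  [NormedAddCommGroup G] [NormedSpace ℂ G] [CompleteSpace G]

theorem isClosed_range_of_finite_quotient [CompleteSpace F] (f : E →L[ℂ] F) (hf : f.range.CoFG) :
    IsClosed (f.range : Set F) := by
  obtain ⟨N, hN⟩ := Submodule.exists_isCompl f.range
  have : FiniteDimensional ℂ N := .of_fg (hf.fg_of_isCompl hN)
  have : CompleteSpace N := FiniteDimensional.complete ℂ N
  let g : (E × N) →L[ℂ] F := f.coprod N.subtypeL
  have hg : Function.Surjective g := by
    refine LinearMap.range_eq_top (f := (g : (E × N) →ₗ[ℂ] F)) |>.1 ?_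
    simp [g, LinearMap.range_coprod, hN.sup_eq_top]
  -- `g` is a quotient map, and `f.range` pulls back along it to `E × 0`.
  rw [← (g.isQuotientMap hg).isClosed_preimage]
  have : g ⁻¹' (f.range : Set F) = Prod.snd ⁻¹' {0} := by
    ext ⟨x, y⟩
    have h1 : f x + (y : F) ∈ f.range ↔ (y : F) ∈ f.range :=
      f.range.add_mem_iff_right ⟨x, rfl⟩
    have h2 : (y : F) ∈ f.range ↔ y = 0 := by
      refine ⟨fun h => ?_, fun h => by simp [h]⟩
      exact Subtype.ext (Submodule.disjoint_def.1 hN.disjoint _ h y.2)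
    simpa [g] using h1.trans h2
  rw [this]
  exact isClosed_singleton.preimage continuous_snd

/-- The range of a bounded operator is closed as soon as it becomes closed after adding a
finite-dimensional subspace. -/
theorem isClosed_range_of_isClosed_sup [CompleteSpace F] (f : E →L[ℂ] F) {N : Submodule ℂ F}
    (hN : N.FG) (h : IsClosed ((f.range ⊔ N : Submodule ℂ F) : Set F)) :
    IsClosed (f.range : Set F) := by
  set M : Submodule ℂ F := f.range ⊔ N
  have : CompleteSpace M := h.completeSpace_coe
  have hfM : ∀ x, f x ∈ M := fun x => le_sup_left (a := f.range) (b := N) ⟨x, rfl⟩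
  let g : E →L[ℂ] M := f.codRestrict M hfM
  have hmap : g.range.map M.subtype = f.range := by
    ext x
    simp only [Submodule.mem_map, LinearMap.mem_range]
    constructor
    · rintro ⟨_, ⟨y, rfl⟩, rfl⟩
      exact ⟨y, rfl⟩
    · rintro ⟨y, rfl⟩
      exact ⟨_, ⟨y, rfl⟩, rfl⟩
  have hfg : (N.comap M.subtype).FG := by
    refine Submodule.fg_of_fg_map_injective M.subtype M.injective_subtype ?_
    rwa [Submodule.map_comap_subtype, inf_eq_right.2 le_sup_right]
  have hcod : Codisjoint (N.comap M.subtype) g.range := by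
    rw [codisjoint_iff]
    refine Submodule.map_injective_of_injective M.injective_subtype ?_
    rw [Submodule.map_sup, hmap, Submodule.map_comap_subtype, inf_eq_right.2 le_sup_right,
      Submodule.map_subtype_top, sup_comm]
  have hg := isClosed_range_of_finite_quotient g (hfg.cofg_of_codisjoint hcod)
  have := h.isClosedEmbedding_subtypeVal.isClosedMap _ hg
  rw [← hmap]
  exact this

/-- The range of a bounded operator is closed if it has finite codimension in a closed subspace. -/
theorem isClosed_range_of_le_sup [CompleteSpace F] (f : E →L[ℂ] F) {M N : Submodule ℂ F}
    (hM : IsClosed (M : Set F)) (hN : N.FG) (hfM : f.range ≤ M) (hMf : M ≤ f.range ⊔ N) :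
    IsClosed (f.range : Set F) := by
  have : FiniteDimensional ℂ N := .of_fg hN
  refine isClosed_range_of_isClosed_sup f hN ?_
  have heq : f.range ⊔ N = M ⊔ N :=
    le_antisymm (sup_le_sup_right hfM N) (sup_le hMf le_sup_right)
  rw [heq]
  exact Submodule.isClosed_sup_finiteDimensional M N hM

/-- If `k ∘ g` is upper semi-Fredholm, then `g` has closed range. -/
theorem isClosed_range_of_comp (k : F →L[ℂ] G) (g : E →L[ℂ] F) (hker : (k ∘L g).ker.FG)
    (hran : IsClosed ((k ∘L g).range : Set G)) : IsClosed (g.range : Set F) := by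
  have : FiniteDimensional ℂ (k ∘L g).ker := .of_fg hker
  obtain ⟨Z, hZ, hc⟩ :=
    (Submodule.ClosedComplemented.of_finiteDimensional (k ∘L g).ker).exists_isClosed_isCompl
  have : CompleteSpace Z := hZ.completeSpace_coe
  have : Z.CoFG := hker.cofg_of_isCompl hc
  -- On a closed complement `Z` of the kernel, `k ∘ g` is bounded below, hence so is `g`.
  let h : Z →L[ℂ] G := (k ∘L g) ∘L Z.subtypeL
  have hinj : Function.Injective h := by
    refine (injective_iff_map_eq_zero h).2 fun x hx => ?_
    exact Subtype.ext (Submodule.disjoint_def.1 hc.disjoint _ (LinearMap.mem_ker.2 hx) x.2)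
  have hrange : Set.range h = ((k ∘L g).range : Set G) := by
    ext y
    constructor
    · rintro ⟨x, rfl⟩
      exact ⟨x, rfl⟩
    · rintro ⟨x, rfl⟩
      obtain ⟨u, hu, v, hv, rfl⟩ := Submodule.mem_sup.1 (hc.sup_eq_top ▸ Submodule.mem_top (x := x))
      refine ⟨⟨v, hv⟩, ?_⟩
      have : (k ∘L g) u = 0 := hu
      change (k ∘L g) v = (k ∘L g) (u + v)
      rw [map_add, this, zero_add]
  obtain ⟨c, hc'⟩ := h.antilipschitz_of_injective_of_isClosed_range hinj (hrange ▸ hran)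
  have hanti : AntilipschitzWith (c * ‖k‖₊) (g ∘L Z.subtypeL) := by
    refine ContinuousLinearMap.antilipschitz_of_bound _ fun x => ?_
    have h1 : ‖x‖ ≤ c * ‖h x‖ := by simpa using hc'.le_mul_dist x 0
    have h2 : ‖h x‖ ≤ ‖k‖ * ‖g x‖ := k.le_opNorm (g x)
    calc ‖x‖ ≤ c * ‖h x‖ := h1
      _ ≤ c * (‖k‖ * ‖g x‖) := by gcongr
      _ = _ := by simp [mul_assoc]
  have hcl := hanti.isClosed_range (g ∘L Z.subtypeL).uniformContinuous
  refine LinearMap.isClosed_range_of_isClosed_map_of_finiteDimensional_quotient (s := Z) ?_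
  convert hcl using 1
  ext y
  simp

end ClosedRange

variable {X : Type*} [NormedAddCommGroup X] [NormedSpace ℂ X]

/-! ### B-Fredholm operators in terms of the subspaces `R(T ^ n)` -/

theorem ker_restrictRangePow_map (T : X →L[ℂ] X) (n : ℕ) :
    (restrictRangePow T n).ker.map (T ^ n).range.subtype = T.ker ⊓ (T ^ n).range := by
  ext x
  simp only [Submodule.mem_map, Submodule.mem_inf]
  constructor
  · rintro ⟨y, hy, rfl⟩
    exact ⟨congrArg Subtype.val hy, y.2⟩
  · rintro ⟨hx, hx'⟩
    exact ⟨⟨x, hx'⟩, Subtype.ext hx, rfl⟩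

theorem range_restrictRangePow_map (T : X →L[ℂ] X) (n : ℕ) :
    (restrictRangePow T n).range.map (T ^ n).range.subtype = (T ^ (n + 1)).range := by
  ext x
  simp only [Submodule.mem_map]
  constructor
  · rintro ⟨_, ⟨⟨_, z, rfl⟩, rfl⟩, rfl⟩
    refine ⟨z, ?_⟩
    rw [pow_succ']
    rfl
  · rintro ⟨z, rfl⟩
    refine ⟨_, ⟨⟨_, z, rfl⟩, rfl⟩, ?_⟩
    rw [pow_succ']
    rfl

theorem range_pow_add_le (T : X →L[ℂ] X) (n j : ℕ) : (T ^ (n + j)).range ≤ (T ^ n).range := by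
  rintro _ ⟨x, rfl⟩
  refine ⟨(T ^ j) x, ?_⟩
  rw [pow_add]
  rfl

/-- B-Fredholmness expressed inside `X`, without the restricted operator or a quotient: finite
codimension of `R(T ^ (n + 1))` in `R(T ^ n)` becomes containment up to a finite-dimensional
summand, a form that survives applying operators to both sides. -/
theorem isBFredholm_iff (T : X →L[ℂ] X) :
    IsBFredholm T ↔ ∃ n : ℕ, IsClosed ((T ^ n).range : Set X) ∧ (T.ker ⊓ (T ^ n).range).FG ∧
      ∃ N : Submodule ℂ X, N.FG ∧ (T ^ n).range ≤ (T ^ (n + 1)).range ⊔ N := by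
  refine exists_congr fun n => and_congr_right fun _ => and_congr ?_ ?_
  · rw [← ker_restrictRangePow_map]
    refine ⟨fun h => (Module.Finite.iff_fg.1 h).map _, fun h => Module.Finite.iff_fg.2 ?_⟩
    exact Submodule.fg_of_fg_map_injective _ (Submodule.injective_subtype _) h
  · set M := (T ^ n).range
    rw [← range_restrictRangePow_map]
    constructor
    · intro h
      obtain ⟨N, hN⟩ := Submodule.exists_isCompl (restrictRangePow T n).range
      refine ⟨N.map M.subtype, (Submodule.CoFG.fg_of_isCompl hN h).map _, ?_⟩
      rw [← Submodule.map_sup, hN.sup_eq_top, Submodule.map_subtype_top]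
    · rintro ⟨N, hN, hle⟩
      have hfg : (N.comap M.subtype).FG := by
        have := Module.Finite.iff_fg.2 hN
        refine Submodule.fg_of_fg_map_injective M.subtype M.injective_subtype ?_
        rw [Submodule.map_comap_subtype, inf_comm]
        exact Module.Finite.iff_fg.1 (Submodule.finiteDimensional_inf_left N M)
      refine hfg.cofg_of_codisjoint ?_
      rw [codisjoint_iff, eq_top_iff]
      rintro ⟨x, hx⟩ -
      obtain ⟨_, ⟨y, hy, rfl⟩, v, hv, hxv⟩ := Submodule.mem_sup.1 (hle hx)
      have hv' : v ∈ M := by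
        rw [← add_sub_cancel_left (M.subtype y) v, hxv]
        exact M.sub_mem hx y.2
      exact Submodule.mem_sup.2 ⟨⟨v, hv'⟩, hv, y, hy, Subtype.ext ((add_comm _ _).trans hxv)⟩

theorem range_pow_le_range_pow_add_sup (T : X →L[ℂ] X) {n : ℕ} {N : Submodule ℂ X} (hN : N.FG)
    (h : (T ^ n).range ≤ (T ^ (n + 1)).range ⊔ N) (j : ℕ) :
    ∃ N' : Submodule ℂ X, N'.FG ∧ (T ^ n).range ≤ (T ^ (n + j)).range ⊔ N' := by
  induction j with
  | zero => exact ⟨⊥, Submodule.fg_bot, le_sup_left⟩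
  | succ j ih =>
    obtain ⟨N', hN', h'⟩ := ih
    refine ⟨N.map ((T ^ j : X →L[ℂ] X) : X →ₗ[ℂ] X) ⊔ N', (hN.map _).sup hN', h'.trans ?_⟩
    rw [← sup_assoc]
    refine sup_le_sup_right ?_ N'
    rintro _ ⟨x, rfl⟩
    obtain ⟨_, ⟨y, rfl⟩, v, hv, hxv⟩ := Submodule.mem_sup.1 (h ⟨x, rfl⟩)
    refine Submodule.mem_sup.2 ⟨_, ⟨y, rfl⟩, _, ⟨v, hv, rfl⟩, ?_⟩
    have h1 : T ^ (n + (j + 1)) = T ^ j * T ^ (n + 1) := by rw [← pow_add]; congr 1; ring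
    have h2 : T ^ (n + j) = T ^ j * T ^ n := by rw [← pow_add, add_comm]
    rw [h1, h2]
    change (T ^ j) ((T ^ (n + 1)) y) + (T ^ j) v = (T ^ j) ((T ^ n) x)
    rw [← map_add]
    exact congrArg _ hxv

theorem fg_ker_pow_inf_range_pow (T : X →L[ℂ] X) {n : ℕ} (h : (T.ker ⊓ (T ^ n).range).FG)
    (j : ℕ) : ((T ^ j).ker ⊓ (T ^ n).range).FG := by
  induction j with
  | zero =>
    have : (T ^ 0).ker = ⊥ := LinearMap.ker_eq_bot.2 fun x y hxy => by simpa using hxy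
    rw [this, bot_inf_eq]
    exact Submodule.fg_bot
  | succ j ih =>
    refine Submodule.fg_of_fg_map_of_fg_inf_ker (T : X →ₗ[ℂ] X) (ih.of_le ?_) (h.of_le ?_)
    · rintro _ ⟨x, ⟨hx, hx'⟩, rfl⟩
      refine ⟨?_, mem_range_pow T n x hx'⟩
      rw [SetLike.mem_coe, LinearMap.mem_ker] at hx ⊢
      rw [pow_succ] at hx
      exact hx
    · rintro x ⟨⟨-, hx⟩, hx'⟩
      exact ⟨hx', hx⟩

/-! ### Transfer along intertwining operators -/

theorem pow_apply_of_intertwine {S T J : X →L[ℂ] X} (h : S * J = J * T) (n : ℕ) (x : X) :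
    (S ^ n) (J x) = J ((T ^ n) x) := by
  have : SemiconjBy J T S := h.symm
  exact congr($((this.pow_right n).symm) x)

/-- B-Fredholmness passes from `T` to `S` along an intertwining pair `J`, `K` for which `J * K`
is coprime to the powers of `S`. -/
theorem IsBFredholm.of_intertwine_of_coprime {S T J K : X →L[ℂ] X} (hJ : S * J = J * T)
    (hK : T * K = K * S)
    (hco : ∀ n : ℕ, ∃ U V : X →L[ℂ] X, Commute U S ∧ Commute V S ∧
      U * S ^ n + V * (J * K) = 1)
    (hT : IsBFredholm T) : IsBFredholm S := by
  rw [isBFredholm_iff] at hT ⊢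
  obtain ⟨n, hcl, hker, N, hN, hle⟩ := hT
  have hKr : ∀ x ∈ (S ^ n).range, K x ∈ (T ^ n).range := by
    rintro _ ⟨y, rfl⟩
    exact ⟨K y, pow_apply_of_intertwine hK n y⟩
  -- `n` serves for closedness; the first power serves for the kernel and the codimension, where
  -- `S x` is `0` or already lies in `R(S ^ (n + 1))`.
  obtain ⟨U, V, hU, hV, hUV⟩ := hco n
  obtain ⟨U₁, V₁, hU₁, hV₁, hUV₁⟩ := hco 1
  have hd₁ : ∀ x, x = U₁ (S x) + V₁ (J (K x)) := fun x => by
    have := congr($hUV₁ x)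
    rw [pow_one] at this
    exact this.symm
  refine ⟨n, ?_, ?_, N.map ((V₁ * J : X →L[ℂ] X) : X →ₗ[ℂ] X), hN.map _, ?_⟩
  · -- Membership in `R(S ^ n)` can be tested after applying `K`.
    have : ((S ^ n).range : Set X) = K ⁻¹' ((T ^ n).range : Set X) := by
      refine Set.Subset.antisymm (fun x hx => hKr x hx) ?_
      rintro x ⟨y, hy⟩
      have hy : (T ^ n) y = K x := hy
      refine ⟨U x + V (J y), ?_⟩
      change (S ^ n) (U x + V (J y)) = x
      have h1 : (S ^ n) (U x) = U ((S ^ n) x) := congr($((hU.pow_right n).eq.symm) x)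
      have h2 : (S ^ n) (V (J y)) = V ((S ^ n) (J y)) := congr($((hV.pow_right n).eq.symm) (J y))
      rw [map_add, h1, h2, pow_apply_of_intertwine hJ, hy]
      exact congr($hUV x)
    rw [this]
    exact hcl.preimage K.continuous
  · refine Submodule.fg_of_fg_map_of_fg_inf_ker (K : X →ₗ[ℂ] X) (hker.of_le ?_) ?_
    · rintro _ ⟨x, ⟨hx, hx'⟩, rfl⟩
      refine ⟨?_, hKr x hx'⟩
      have hx : S x = 0 := hx
      have h1 : T (K x) = K (S x) := congr($hK x)
      rw [hx, map_zero] at h1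
      exact h1
    · have : (S.ker ⊓ (S ^ n).range) ⊓ LinearMap.ker (K : X →ₗ[ℂ] X) = ⊥ := by
        rw [eq_bot_iff]
        rintro x ⟨⟨hx, -⟩, hx'⟩
        have hx : S x = 0 := hx
        have hx' : K x = 0 := hx'
        have := hd₁ x
        rwa [hx, hx', map_zero, map_zero, map_zero, add_zero] at this
      rw [this]
      exact Submodule.fg_bot
  · intro x hx
    obtain ⟨_, ⟨a, rfl⟩, v, hv, hav⟩ := Submodule.mem_sup.1 (hle (hKr x hx))
    have hav : (T ^ (n + 1)) a + v = K x := hav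
    obtain ⟨y, hy⟩ := hx
    have hy : (S ^ n) y = x := hy
    refine Submodule.mem_sup.2
      ⟨_, ⟨U₁ y + V₁ (J a), rfl⟩, V₁ (J v), ⟨v, hv, rfl⟩, ?_⟩
    change (S ^ (n + 1)) (U₁ y + V₁ (J a)) + V₁ (J v) = x
    have h1 : (S ^ (n + 1)) (U₁ y) = U₁ ((S ^ (n + 1)) y) :=
      congr($((hU₁.pow_right (n + 1)).eq.symm) y)
    have h2 : (S ^ (n + 1)) (V₁ (J a)) = V₁ ((S ^ (n + 1)) (J a)) :=
      congr($((hV₁.pow_right (n + 1)).eq.symm) (J a))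
    have h3 : (S ^ (n + 1)) y = S x := by
      rw [← hy, pow_succ']
      rfl
    rw [map_add, h1, h2, h3, pow_apply_of_intertwine hJ, add_assoc, ← map_add, ← map_add, hav]
    exact (hd₁ x).symm

/-- B-Fredholmness passes from `T` to `S` along an intertwining pair `J`, `K` whose two products
are equal powers of `T` and `S`. -/
theorem IsBFredholm.of_intertwine_of_mul_eq_pow [CompleteSpace X] {S T J K : X →L[ℂ] X} {p : ℕ}
    (hJ : S * J = J * T) (hKJ : K * J = T ^ p) (hJK : J * K = S ^ p)
    (hT : IsBFredholm T) : IsBFredholm S := by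
  rw [isBFredholm_iff] at hT ⊢
  obtain ⟨n, hcl, hker, N, hN, hle⟩ := hT
  have hSJ := pow_apply_of_intertwine hJ
  have hJK' : ∀ x, (S ^ (n + p)) x = J ((T ^ n) (K x)) := fun x => by
    rw [pow_add, ← hJK, ← hSJ]
    rfl
  have hmap : ∀ j (N' : Submodule ℂ X), (T ^ n).range ≤ (T ^ (n + j)).range ⊔ N' →
      (T ^ n).range.map (J : X →ₗ[ℂ] X) ≤ (S ^ (n + j)).range ⊔ N'.map (J : X →ₗ[ℂ] X) := by
    intro j N' h
    refine (Submodule.map_mono h).trans ?_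
    rw [Submodule.map_sup]
    refine sup_le_sup_right ?_ _
    rintro _ ⟨_, ⟨y, rfl⟩, rfl⟩
    exact ⟨J y, hSJ (n + j) y⟩
  have hrange : (S ^ (n + p)).range ≤ (T ^ n).range.map (J : X →ₗ[ℂ] X) := by
    rintro _ ⟨x, rfl⟩
    exact ⟨_, ⟨K x, rfl⟩, (hJK' x).symm⟩
  obtain ⟨N₁, hN₁, hle₁⟩ := range_pow_le_range_pow_add_sup T hN hle p
  obtain ⟨N₂, hN₂, hle₂⟩ := range_pow_le_range_pow_add_sup T hN hle (p + 1)
  refine ⟨n + p, ?_, ?_, N₂.map (J : X →ₗ[ℂ] X), hN₂.map _, hrange.trans (hmap (p + 1) N₂ hle₂)⟩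
  · have : CompleteSpace (T ^ n).range := hcl.completeSpace_coe
    have hclosed : IsClosed ((T ^ n).range.map (J : X →ₗ[ℂ] X) : Set X) := by
      let g : (T ^ n).range →L[ℂ] X := J ∘L (T ^ n).range.subtypeL
      have hKg : ∀ x, (K ∘L g) x = (T ^ p) x := fun x => congr($hKJ x)
      have hg : (g.range : Set X) = ((T ^ n).range.map (J : X →ₗ[ℂ] X) : Set X) := by
        ext x
        constructor
        · rintro ⟨y, rfl⟩
          exact ⟨y, y.2, rfl⟩
        · rintro ⟨y, hy, rfl⟩
          exact ⟨⟨y, hy⟩, rfl⟩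
      rw [← hg]
      refine isClosed_range_of_comp K g ?_ ?_
      · refine Submodule.fg_of_fg_map_injective (T ^ n).range.subtype
          (Submodule.injective_subtype _) ((fg_ker_pow_inf_range_pow T hker p).of_le ?_)
        rintro _ ⟨x, hx, rfl⟩
        exact ⟨(hKg x).symm.trans hx, x.2⟩
      · have : ((K ∘L g).range : Set X) = ((T ^ (n + p)).range : Set X) := by
          have hnp : ∀ x, (T ^ p) ((T ^ n) x) = (T ^ (n + p)) x := fun x => by
            rw [add_comm, pow_add]
            rfl
          ext x
          constructor
          · rintro ⟨⟨_, y, rfl⟩, rfl⟩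
            exact ⟨y, (hnp y).symm.trans (hKg ⟨(T ^ n) y, y, rfl⟩).symm⟩
          · rintro ⟨y, rfl⟩
            exact ⟨⟨_, y, rfl⟩, (hKg ⟨(T ^ n) y, y, rfl⟩).trans (hnp y)⟩
        rw [this]
        exact isClosed_range_of_le_sup _ hcl hN₁ (range_pow_add_le T n p) hle₁
    exact isClosed_range_of_le_sup _ hclosed (hN₁.map _) hrange (hmap p N₁ hle₁)
  · refine ((fg_ker_pow_inf_range_pow T hker (p + 1)).map (J : X →ₗ[ℂ] X)).of_le ?_
    rintro z ⟨hz, y, rfl⟩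
    have hz : S ((S ^ (n + p)) y) = 0 := hz
    rw [hJK' y] at hz
    refine ⟨(T ^ n) (K y), ⟨?_, ⟨K y, rfl⟩⟩, (hJK' y).symm⟩
    set w := (T ^ n) (K y)
    have h1 : (T ^ (p + 1)) w = K (J (T w)) := by
      rw [pow_succ, ← hKJ]
      rfl
    have h2 : J (T w) = S (J w) := congr($hJ.symm w)
    rw [h2, hz, map_zero] at h1
    exact h1

theorem exists_coprime_pow_add_smul_pow (S : X →L[ℂ] X) {z : ℂ} (hz : z ≠ 0) (n p : ℕ) :
    ∃ U V : X →L[ℂ] X, Commute U S ∧ Commute V S ∧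
      U * S ^ n + V * (S + z • (1 : X →L[ℂ] X)) ^ p = 1 := by
  have hco : IsCoprime (Polynomial.X : Polynomial ℂ) (Polynomial.X + Polynomial.C z) := by
    refine ⟨-Polynomial.C z⁻¹, Polynomial.C z⁻¹, ?_⟩
    have : Polynomial.C z⁻¹ * Polynomial.C z = (1 : Polynomial ℂ) := by
      rw [← Polynomial.C_mul, inv_mul_cancel₀ hz, Polynomial.C_1]
    linear_combination this
  obtain ⟨u, v, huv⟩ := (hco.pow (m := n) (n := p))
  have hcomm : ∀ q : Polynomial ℂ, Commute (Polynomial.aeval S q) S := fun q => by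
    have := (Commute.all q Polynomial.X).map (Polynomial.aeval S)
    rwa [Polynomial.aeval_X] at this
  refine ⟨Polynomial.aeval S u, Polynomial.aeval S v, hcomm u, hcomm v, ?_⟩
  have := congrArg (Polynomial.aeval S) huv
  simpa [Algebra.algebraMap_eq_smul_one] using this

/-- If `J` and `K` intertwine `P` and `Q` and their products are the `p`-th powers of `P` and `Q`,
then B-Fredholmness passes from `P - z` to `Q - z` for every `z`. -/
theorem IsBFredholm.sub_smul_one_of_intertwine [CompleteSpace X] {P Q J K : X →L[ℂ] X} {p : ℕ}
    (hJ : Q * J = J * P) (hK : P * K = K * Q) (hKJ : K * J = P ^ p) (hJK : J * K = Q ^ p) (z : ℂ)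
    (h : IsBFredholm (P - z • (1 : X →L[ℂ] X))) : IsBFredholm (Q - z • (1 : X →L[ℂ] X)) := by
  rcases eq_or_ne z 0 with rfl | hz
  · rw [zero_smul, sub_zero] at h ⊢
    exact h.of_intertwine_of_mul_eq_pow hJ hKJ hJK
  · refine h.of_intertwine_of_coprime (J := J) (K := K) ?_ ?_ fun n => ?_
    · simp [sub_mul, mul_sub, hJ]
    · simp [sub_mul, mul_sub, hK]
    · rw [hJK]
      simpa using exists_coprime_pow_add_smul_pow (Q - z • (1 : X →L[ℂ] X)) hz n p

end BFredholm

theorem corollary4p5 {X : Type*} [NormedAddCommGroup X] [NormedSpace ℂ X] [CompleteSpace X]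
    (A B C : X →L[ℂ] X)
    (hB : (A * B * A) * B = (A * C * A) * B)
    (hC : (A * B * A) * C = (A * C * A) * C) :
    BFredholm.bFredholmSpectrum (A * C) = BFredholm.bFredholmSpectrum (B * A) := by
  simp only [mul_assoc] at hB hC
  have hJ : (B * A) * (B * A * C) = (B * A * C) * (A * C) := by
    simp only [mul_assoc, hC]
  have hK : (A * C) * (A * B * A) = (A * B * A) * (B * A) := by
    have := congrArg (· * A) hB
    simp only [mul_assoc] at this ⊢
    exact this.symm
  have hKJ : (A * B * A) * (B * A * C) = (A * C) ^ 3 := by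
    have h2 := congrArg (· * (A * C)) hC
    simp only [mul_assoc, pow_succ, pow_zero, one_mul] at h2 ⊢
    rw [hC, h2]
  have hJK : (B * A * C) * (A * B * A) = (B * A) ^ 3 := by
    have := congrArg (B * · * A) hB
    simp only [mul_assoc, pow_succ, pow_zero, one_mul] at this ⊢
    exact this.symm
  ext z
  exact not_congr
    ⟨BFredholm.IsBFredholm.sub_smul_one_of_intertwine hJ hK hKJ hJK z,
      BFredholm.IsBFredholm.sub_smul_one_of_intertwine hK hJ hJK hKJ z⟩
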